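/- **Setting.** Let $Q\subset\mathbb R^2$ be a square of area $E_l>0$ (side $\sqrt{E_l}$). It contains $n\ge 1$ target points and the initial positions of $m\ge 1$ robots, which move with unit speed. Two robots can communicate directly when their distance is at most $r>0$. Robots are connected if they are joined by a chain of such links; a *group* is a connected component of this communication graph. **The constants.** Call $(c_1,c_2)$, with $c_1\in\mathbb N$ and $c_2>0$, *admissible for $E_l$* if for every $N\ge c_1$ the shortest closed tour through any $N$ points of $Q$ has length at most $c_2\sqrt{N E_l}$. **The algorithm STSTC.** Let $TSP_0$ be a closed tour through all targets that is produced by the Christofides algorithm: a minimum spanning tree plus a minimum-length perfect matching of its odd-degree vertices, then an Eulerian circuit, shortcut to a tour. The route $o_j$ of robot $j$ is initially $TSP_0$, traversed from the starting target and in the direction that minimise the length of the route from the robot's initial position through all the targets in that order. The planned total travel time $t_j$ is the distance robot $j$ has already travelled plus the length of its remaining route. At the instants $t=0,\delta,2\delta,\dots$ (for some sampling period $\delta>0$) the following happens. 1. The robots of each group pool their knowledge of which targets have been visited, and each robot deletes from its route the targets it knows to be visited. 2. A group that is the same as at the previous instant, or that consists of one robot, keeps its routes. (Before $t=0$ every robot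 counts as a group of its own.) A group with a new member reassigns targets; a group of at least two robots that has only lost members may do either. To reassign in a group $\mathcal R_i$, let $\mathcal R_i^1$ be the set of its robots that were never connected with another robot before, $\mathcal R_i^2=\mathcal R_i\setminus\mathcal R_i^1$, and let $p$ minimise $t_q$ over $q\in\mathcal R_i^1$. The cooperative targets are those on $o_p$ if $\mathcal R_i^2=\emptyset$, or if $p$ exists and $\sum_{k\in\mathcal R_i^2}(t_k-t)\ge t_p-t$; otherwise they are those in $\bigcup_{k\in\mathcal R_i^2}o_k$. An arbitrary heuristic divides the cooperative targets into ordered routes for the robots of $\mathcal R_i$, each target going to exactly one robot. The division replaces the routes in the group if it strictly decreases $\sum_{j\in\mathcal R_i}t_j$; otherwise all its robots keep their routes. 3. Each robot moves at unit speed straight from target to target along its route until the next instant, and stops when its route is finished (it may start again if it is later assigned targets). **Theorem.** There is an absolute constant $c_2>0$ such that $(1,c_2)$ is admissible for every $E_l>0$. Moreover, for every $E_l>0$, every pair $(c_1,c_2)$ that is admissible for $E_l$, all $m\ge1$ and $n\ge\max(1,c_1)$, all positions of the targets and robots in $Q$, all $r,\delta>0$, every Christofides tour $TSP_0$ and every execution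 of the STSTC, there is a finite time by which all $n$ targets have been visited and after which no robot moves any more, and the total travel time of the $m$ robots is at most $$m\left(\sqrt{2E_l}+\tfrac32\,c_2\sqrt{nE_l}\right).$$ -/

import Mathlib

open scoped BigOperators

noncomputable section

namespace STSTC

open Classical

/-- The plane with its Euclidean metric. -/
abbrev Plane : Type := EuclideanSpace ℝ (Fin 2)

/-- The axis-parallel closed square of area `E` with a corner at the origin. -/
def square (E : ℝ) : Set Plane := {p | ∀ i, 0 ≤ p i ∧ p i ≤ Real.sqrt E}

/-! ### Routes and tours -/

/-- Length of the open route that starts at `p` and goes through the points of `l` in order. -/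
def routeLength {n : ℕ} (x : Fin n → Plane) : Plane → List (Fin n) → ℝ
  | _, [] => 0
  | p, w :: l => dist p (x w) + routeLength x (x w) l

/-- A tour lists every point exactly once (and is read cyclically). -/
def IsTour {n : ℕ} (l : List (Fin n)) : Prop := l.Nodup ∧ ∀ w, w ∈ l

/-- Length of the closed tour `l`: the route from its first point through all others and back. -/
def tourLength {n : ℕ} (x : Fin n → Plane) : List (Fin n) → ℝ
  | [] => 0
  | w :: l => routeLength x (x w) (l ++ [w])

/-- A shortest closed tour through the points `x`, i.e. an optimal TSP tour. -/
def IsShortestTour {n : ℕ} (x : Fin n → Plane) (l : List (Fin n)) : Prop :=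
  IsTour l ∧ ∀ l', IsTour l' → tourLength x l ≤ tourLength x l'

/-- `c₁, c₂` are admissible constants in the TSP length bound for the square of area `E`: the
shortest tour through any `N ≥ c₁` points of the square has length at most `c₂ √(N E)`. -/
def IsTSPConstant (E : ℝ) (c₁ : ℕ) (c₂ : ℝ) : Prop :=
  ∀ N : ℕ, c₁ ≤ N → ∀ x : Fin N → Plane, (∀ i, x i ∈ square E) →
    ∀ l, IsShortestTour x l → tourLength x l ≤ c₂ * Real.sqrt (N * E)

/-! ### The Christofides algorithm -/

/-- Euclidean length of an edge. -/
def edgeLength {n : ℕ} (x : Fin n → Plane) : Sym2 (Fin n) → ℝ :=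
  Sym2.lift ⟨fun i j => dist (x i) (x j), fun i j => dist_comm (x i) (x j)⟩

/-- Total length of the edges of a graph on the points. -/
def weight {n : ℕ} (x : Fin n → Plane) (G : SimpleGraph (Fin n)) : ℝ :=
  ∑ e ∈ G.edgeFinset, edgeLength x e

/-- A minimum spanning tree. -/
def IsMST {n : ℕ} (x : Fin n → Plane) (T : SimpleGraph (Fin n)) : Prop :=
  T.IsTree ∧ ∀ T' : SimpleGraph (Fin n), T'.IsTree → weight x T ≤ weight x T'

/-- `M` is a perfect matching of the odd-degree vertices of `T` (no other vertex is touched). -/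
def IsOddMatching {n : ℕ} (T M : SimpleGraph (Fin n)) : Prop :=
  ∀ v, M.degree v = if Odd (T.degree v) then 1 else 0

/-- A perfect matching of the odd-degree vertices of `T` of minimum total length. -/
def IsMinOddMatching {n : ℕ} (x : Fin n → Plane) (T M : SimpleGraph (Fin n)) : Prop :=
  IsOddMatching T M ∧ ∀ M', IsOddMatching T M' → weight x M ≤ weight x M'

/-- `tour` is a possible output of the Christofides algorithm: take a minimum spanning tree `T`, a
minimum-length perfect matching `M` of the odd-degree vertices of `T`, an Eulerian circuit of the
multigraph `T + M` (edges common to both are doubled), and shortcut the circuit by skipping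
repeated vertices. -/
def IsChristofidesTour {n : ℕ} (x : Fin n → Plane) (tour : List (Fin n)) : Prop :=
  IsTour tour ∧
  ∃ T M : SimpleGraph (Fin n), IsMST x T ∧ IsMinOddMatching x T M ∧
    ∃ (v : Fin n) (c : (⊤ : SimpleGraph (Fin n)).Walk v v),
      (c.edges : Multiset (Sym2 (Fin n))) = T.edgeFinset.val + M.edgeFinset.val ∧
      tour.Sublist c.support

/-! ### States of the robot system -/

/-- State of `m` robots and `n` targets at a sampling instant. -/
structure State (m n : ℕ) where
  /-- current time `t` -/
  time : ℝ
  /-- position `p_j` -/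
  pos : Fin m → Plane
  /-- ordered targets `o_j` still on the route of robot `j` -/
  route : Fin m → List (Fin n)
  /-- targets that robot `j` knows to have been visited (`s_j`) -/
  known : Fin m → Finset (Fin n)
  /-- robots with which robot `j` has ever been connected (`u_j`) -/
  met : Fin m → Finset (Fin m)
  /-- connected group of robot `j` at the previous instant -/
  lastGroup : Fin m → Finset (Fin m)
  /-- distance travelled so far, i.e. (unit speed) travel time spent so far, by robot `j` -/
  travelled : Fin m → ℝ
  /-- targets physically reached so far by robot `j` -/
  visited : Fin m → Finset (Fin n)

/-- Planned total travel time `t_j`: the time already travelled plus the length of the remaining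
route. -/
def planned {m n : ℕ} (x : Fin n → Plane) (S : State m n) (j : Fin m) : ℝ :=
  S.travelled j + routeLength x (S.pos j) (S.route j)

/-- Communication graph: two robots are linked when their distance is at most `r`. -/
def commGraph {m : ℕ} (r : ℝ) (p : Fin m → Plane) : SimpleGraph (Fin m) where
  Adj j k := j ≠ k ∧ dist (p j) (p k) ≤ r
  symm := ⟨fun _ _ h => ⟨h.1.symm, by rw [dist_comm]; exact h.2⟩⟩
  loopless := ⟨fun _ h => h.1 rfl⟩

/-- The group of communication-connected robots that contains `j`. -/
def group {m n : ℕ} (r : ℝ) (S : State m n) (j : Fin m) : Finset (Fin m) :=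
  Finset.univ.filter fun k => (commGraph r S.pos).Reachable j k

/-- `l` runs once through the tour `tour`, from some starting target, in one of the two directions.
-/
def FollowsTour {n : ℕ} (tour l : List (Fin n)) : Prop :=
  l.IsRotated tour ∨ l.IsRotated tour.reverse

/-- Initial states: every robot plans to follow the common tour, with starting target and direction
chosen so as to minimise the length of its route. -/
def IsInitial {m n : ℕ} (x : Fin n → Plane) (p : Fin m → Plane) (tour : List (Fin n))
    (S : State m n) : Prop :=
  S.time = 0 ∧ S.pos = p ∧
  (∀ j, FollowsTour tour (S.route j) ∧
    ∀ l, FollowsTour tour l → routeLength x (p j) (S.route j) ≤ routeLength x (p j) l) ∧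
  (∀ j, S.known j = ∅) ∧ (∀ j, S.met j = ∅) ∧ (∀ j, S.lastGroup j = {j}) ∧
  (∀ j, S.travelled j = 0) ∧ (∀ j, S.visited j = ∅)

/-! ### Communication and cooperation -/

/-- Information exchange: connected robots pool what they know about visited targets, and every
robot deletes from its route the targets it now knows to be visited. -/
def exchange {m n : ℕ} (r : ℝ) (S : State m n) : State m n :=
  { S with
    known := fun j => (group r S j).biUnion S.known
    route := fun j => (S.route j).filter fun w => w ∉ (group r S j).biUnion S.known }

/-- Members of the group `C` that have not been connected with another robot before now. -/
def fresh {m n : ℕ} (S : State m n) (C : Finset (Fin m)) : Finset (Fin m) :=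
  C.filter fun j => ∀ k ∈ S.met j, k = j

/-- `T` is the set of cooperative targets of the group `C`. Let `p` have least planned time among
the fresh robots of `C`. If `C` has only fresh robots, or `p` exists and its remaining time is at
most the sum of those of the other, non-fresh robots, then `T` is the set of targets on the route
of `p`; otherwise it is the union of the targets on the routes of the non-fresh robots. -/
def IsCoopTargets {m n : ℕ} (x : Fin n → Plane) (S : State m n) (C : Finset (Fin m))
    (T : Finset (Fin n)) : Prop :=
  (∃ p ∈ fresh S C, (∀ q ∈ fresh S C, planned x S p ≤ planned x S q) ∧
    (C \ fresh S C = ∅ ∨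
      ∑ k ∈ C \ fresh S C, (planned x S k - S.time) ≥ planned x S p - S.time) ∧
    T = (S.route p).toFinset) ∨
  (C \ fresh S C ≠ ∅ ∧
    (∀ p ∈ fresh S C, (∀ q ∈ fresh S C, planned x S p ≤ planned x S q) →
      ∑ k ∈ C \ fresh S C, (planned x S k - S.time) < planned x S p - S.time) ∧
    T = (C \ fresh S C).biUnion fun k => (S.route k).toFinset)

/-- `cand` divides the targets in `T` into ordered routes for the robots in `C`, every target being
given to exactly one robot. -/
def IsDivision {m n : ℕ} (C : Finset (Fin m)) (T : Finset (Fin n))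
    (cand : Fin m → List (Fin n)) : Prop :=
  (∀ j ∈ C, (cand j).Nodup) ∧
  (∀ j ∈ C, ∀ k ∈ C, j ≠ k → (cand j).Disjoint (cand k)) ∧
  (∀ w, w ∈ T ↔ ∃ j ∈ C, w ∈ cand j)

/-- The group `C` leaves all its routes unchanged. -/
def Keeps {m n : ℕ} (S : State m n) (C : Finset (Fin m)) (ρ : Fin m → List (Fin n)) : Prop :=
  ∀ j ∈ C, ρ j = S.route j

/-- The leader of the group `C` computes some division `cand` of the cooperative targets (the
heuristic is unspecified, so `cand` is arbitrary). It is adopted exactly if it decreases the total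
planned travel time of the group; otherwise all robots of `C` keep their routes. -/
def Reassigns {m n : ℕ} (x : Fin n → Plane) (S : State m n) (C : Finset (Fin m))
    (ρ : Fin m → List (Fin n)) : Prop :=
  ∃ (T : Finset (Fin n)) (cand : Fin m → List (Fin n)),
    IsCoopTargets x S C T ∧ IsDivision C T cand ∧
    ((∑ j ∈ C, planned x { S with route := cand } j < ∑ j ∈ C, planned x S j ∧
        ∀ j ∈ C, ρ j = cand j) ∨
      (∑ j ∈ C, planned x S j ≤ ∑ j ∈ C, planned x { S with route := cand } j ∧
        Keeps S C ρ))

/-- No robot has joined the group `C` since the previous instant. -/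
def NoNewMember {m n : ℕ} (S : State m n) (C : Finset (Fin m)) : Prop :=
  ∀ j ∈ C, C ⊆ S.lastGroup j

/-- The group `C` is the same as at the previous instant. -/
def Unchanged {m n : ℕ} (S : State m n) (C : Finset (Fin m)) : Prop :=
  ∀ j ∈ C, S.lastGroup j = C

/-- Decision of one group. A robot on its own keeps its route, and so does an unchanged group; a
group with a new member reassigns. A group of at least two robots that has merely lost members may
do either. -/
def GroupDecides {m n : ℕ} (x : Fin n → Plane) (S : State m n) (C : Finset (Fin m))
    (ρ : Fin m → List (Fin n)) : Prop :=
  (NoNewMember S C ∧ Keeps S C ρ) ∨ (2 ≤ C.card ∧ ¬ Unchanged S C ∧ Reassigns x S C ρ)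

/-! ### Motion -/

/-- End of a motion: final position, remaining route, targets reached, distance travelled. -/
structure Motion (n : ℕ) where
  pos : Plane
  route : List (Fin n)
  reached : Finset (Fin n)
  length : ℝ

/-- Motion at unit speed during a time `b` from `p` along the route, straight from target to
target; the robot stops once its route is finished. -/
def move {n : ℕ} (x : Fin n → Plane) : Plane → List (Fin n) → ℝ → Motion n
  | p, [], _ => ⟨p, [], ∅, 0⟩
  | p, w :: l, b =>
    if dist p (x w) ≤ b then
      let M := move x (x w) l (b - dist p (x w))
      ⟨M.pos, M.route, insert w M.reached, dist p (x w) + M.length⟩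
    else
      ⟨p + (b / dist p (x w)) • (x w - p), w :: l, ∅, b⟩

/-- One sampling period of length `δ`: exchange of information within every connected group,
decisions `ρ` of all groups, and then motion during a time `δ`. -/
def Step {m n : ℕ} (x : Fin n → Plane) (r δ : ℝ) (S S' : State m n) : Prop :=
  ∃ ρ : Fin m → List (Fin n),
    (∀ j, GroupDecides x (exchange r S) (group r S j) ρ) ∧
    S' =
      { time := S.time + δ
        pos := fun j => (move x (S.pos j) (ρ j) δ).pos
        route := fun j => (move x (S.pos j) (ρ j) δ).route
        known := fun j => (exchange r S).known j ∪ (move x (S.pos j) (ρ j) δ).reached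
        met := fun j => S.met j ∪ group r S j
        lastGroup := fun j => group r S j
        travelled := fun j => S.travelled j + (move x (S.pos j) (ρ j) δ).length
        visited := fun j => S.visited j ∪ (move x (S.pos j) (ρ j) δ).reached }

/-- An execution of the algorithm for targets `x`, initial robot positions `p`, communication range
`r`, sampling period `δ` and common tour `tour`. -/
def IsExecution {m n : ℕ} (x : Fin n → Plane) (p : Fin m → Plane) (r δ : ℝ)
    (tour : List (Fin n)) (S : ℕ → State m n) : Prop :=
  IsInitial x p tour (S 0) ∧ ∀ k, Step x r δ (S k) (S (k + 1))

end STSTC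

end

/-! The cost bound rests on the potential `∑ j, planned x S j`, which never increases
(`Step.sum_planned_le`). Deleting visited targets shortens routes by the triangle inequality, a
division is adopted only if it lowers the group's sum, and motion turns remaining length into
travelled length. Initially each summand is at most the diagonal of the square plus the length of
the common tour (`IsInitial.sum_planned_le`). That tour is within 3/2 of the optimum
(`IsChristofidesTour.tourLength_le`), and the optimum is bounded by admissibility.

Termination uses a second, nondecreasing quantity, `progress`. In each period a robot with a
nonempty route either learns of a new visit or travels for the whole period, so progress grows by at
least 1. Since travelled distance and knowledge are bounded, all routes are eventually empty
(`Step.idle`). The invariant `Covers` says that no unvisited target drops off all relevant routes,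
so empty routes mean that everything has been visited.

That (1, 32) is admissible follows by inserting points one at a time: among many points of a square
two are close, and adding one of them next to the other is cheap. -/

noncomputable section

namespace STSTC

open Classical

/-! ### Lengths of routes and tours, and short tours in a square. -/

section Routes

variable {n : ℕ} (x : Fin n → Plane)

lemma routeLength_nonneg (p : Plane) (l : List (Fin n)) : 0 ≤ routeLength x p l := by
  induction l generalizing p with
  | nil => simp [routeLength]
  | cons w l ih => simpa [routeLength] using add_nonneg dist_nonneg (ih _)

lemma tourLength_nonneg (l : List (Fin n)) : 0 ≤ tourLength x l := by
  cases l with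
  | nil => simp [tourLength]
  | cons w l => exact routeLength_nonneg _ _ _

lemma routeLength_le_dist_add (p q : Plane) (l : List (Fin n)) :
    routeLength x p l ≤ dist p q + routeLength x q l := by
  cases l with
  | nil => simp [routeLength]
  | cons w l => simp only [routeLength]; linarith [dist_triangle p q (x w)]

lemma routeLength_sublist {l l' : List (Fin n)} (h : l.Sublist l') (p : Plane) :
    routeLength x p l ≤ routeLength x p l' := by
  induction h generalizing p with
  | slnil => exact le_rfl
  | cons a _ ih =>
    exact (routeLength_le_dist_add x p (x a) _).trans (by simpa [routeLength] using ih (x a))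
  | cons_cons a _ ih => simpa [routeLength] using ih (x a)

lemma routeLength_append_pair (p : Plane) (l : List (Fin n)) (a b : Fin n) :
    routeLength x p (l ++ [a, b]) = routeLength x p (l ++ [a]) + dist (x a) (x b) := by
  induction l generalizing p with
  | nil => simp [routeLength]
  | cons w l ih => simp [routeLength, ih, add_assoc]

/-- Skipping the head also moves the closing point of the cycle, so the tour is reread from its
second point `b`, and the old head becomes a detour just before the return to `b`. -/
lemma tourLength_sublist {l l' : List (Fin n)} (h : l.Sublist l') :
    tourLength x l ≤ tourLength x l' := by
  induction h with
  | slnil => exact le_rfl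
  | @cons l₁ l₂ a _ ih =>
    refine ih.trans ?_
    cases l₂ with
    | nil => exact tourLength_nonneg _ _
    | cons b l₂ =>
      have h1 : routeLength x (x b) (l₂ ++ [b]) ≤ routeLength x (x b) (l₂ ++ [a, b]) :=
        routeLength_sublist x (List.Sublist.append_left (by simp) _) _
      rw [routeLength_append_pair] at h1
      simp only [tourLength, List.cons_append, routeLength]
      linarith
  | cons_cons a h _ => exact routeLength_sublist x (h.append_right _) _

/-! ### Insertion of a point into a tour -/

lemma routeLength_insert (p : Plane) (l₁ l₂ : List (Fin n)) (u w : Fin n) :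
    routeLength x p (l₁ ++ u :: w :: l₂) ≤
      routeLength x p (l₁ ++ u :: l₂) + 2 * dist (x u) (x w) := by
  induction l₁ generalizing p with
  | nil =>
    have := routeLength_le_dist_add x (x w) (x u) l₂
    rw [dist_comm] at this
    simp only [List.nil_append, routeLength]
    linarith
  | cons a l₁ ih =>
    have := ih (x a)
    simp only [List.cons_append, routeLength]
    linarith

/-- Visiting `w` right after `u` costs at most the round trip from `u` to `w` and back. -/
lemma exists_perm_tourLength_insert {l : List (Fin n)} {u : Fin n} (hu : u ∈ l) (w : Fin n) :
    ∃ l', l'.Perm (w :: l) ∧ tourLength x l' ≤ tourLength x l + 2 * dist (x u) (x w) := by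
  cases l with
  | nil => simp at hu
  | cons a l =>
    rcases List.mem_cons.1 hu with rfl | hu
    · refine ⟨u :: w :: l, List.Perm.swap _ _ _, ?_⟩
      have := routeLength_le_dist_add x (x w) (x u) (l ++ [u])
      rw [dist_comm] at this
      simp only [tourLength, List.cons_append, routeLength]
      linarith
    · obtain ⟨l₁, l₂, rfl⟩ := List.append_of_mem hu
      refine ⟨a :: (l₁ ++ u :: w :: l₂), ?_, ?_⟩
      · rw [List.perm_iff_count]
        intro b
        simp only [List.count_cons, List.count_append]
        ring
      · simpa [tourLength] using routeLength_insert x (x a) l₁ (l₂ ++ [a]) u w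

/-! ### Points in a square -/

lemma dist_le_abs_add_abs (p q : Plane) : dist p q ≤ |p 0 - q 0| + |p 1 - q 1| := by
  rw [EuclideanSpace.dist_eq, Fin.sum_univ_two, Real.dist_eq, Real.dist_eq]
  refine Real.sqrt_le_iff.2 ⟨by positivity, ?_⟩
  nlinarith [mul_nonneg (abs_nonneg (p 0 - q 0)) (abs_nonneg (p 1 - q 1))]

lemma dist_le_of_mem_square {E : ℝ} (hE : 0 ≤ E) {p q : Plane} (hp : p ∈ square E)
    (hq : q ∈ square E) : dist p q ≤ Real.sqrt (2 * E) := by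
  rw [EuclideanSpace.dist_eq, Fin.sum_univ_two, Real.dist_eq, Real.dist_eq]
  apply Real.sqrt_le_sqrt
  have key : ∀ i, |p i - q i| ^ 2 ≤ E := fun i => by
    rw [← Real.sq_sqrt hE]
    refine pow_le_pow_left₀ (abs_nonneg _) ?_ 2
    rw [abs_le]
    constructor <;> linarith [(hp i).1, (hp i).2, (hq i).1, (hq i).2]
  linarith [key 0, key 1]

/-- Pigeonhole on a grid with `k * k` cells. -/
lemma exists_dist_le_of_sq_lt_card {E : ℝ} (hE : 0 < E) (hx : ∀ i, x i ∈ square E)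
    {A : Finset (Fin n)} {k : ℕ} (hk : 0 < k) (hA : k * k < A.card) :
    ∃ u ∈ A, ∃ w ∈ A, u ≠ w ∧ dist (x u) (x w) ≤ 4 * Real.sqrt E / k := by
  have hs : 0 < Real.sqrt E := Real.sqrt_pos.2 hE
  set s := Real.sqrt E
  have hk' : (0 : ℝ) < k := by exact_mod_cast hk
  -- The cells have side `2 * s / k` instead of `s / k`, so that points on the upper boundary of the
  -- closed square also get an index below `k`.
  have hfl : ∀ w i, ⌊k * x w i / (2 * s)⌋₊ < k := fun w i => by
    rw [Nat.floor_lt' hk.ne', div_lt_iff₀ (by positivity)]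
    nlinarith [(hx w i).2]
  have hnn : ∀ w i, 0 ≤ k * x w i / (2 * s) := fun w i =>
    div_nonneg (mul_nonneg hk'.le (hx w i).1) (by positivity)
  let cell : Fin n → ℕ × ℕ := fun w => (⌊k * x w 0 / (2 * s)⌋₊, ⌊k * x w 1 / (2 * s)⌋₊)
  have hcell : ∀ w ∈ A, cell w ∈ Finset.range k ×ˢ Finset.range k := fun w _ => by
    simp [cell, hfl]
  obtain ⟨u, hu, w, hw, huw, he⟩ :=
    Finset.exists_ne_map_eq_of_card_lt_of_maps_to (by simpa using hA) hcell
  refine ⟨u, hu, w, hw, huw, ?_⟩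
  have key : ∀ i, ⌊k * x u i / (2 * s)⌋₊ = ⌊k * x w i / (2 * s)⌋₊ →
      |x u i - x w i| ≤ 2 * s / k := fun i h => by
    have h1 := Nat.floor_le (hnn u i)
    have h2 := Nat.lt_floor_add_one (k * x u i / (2 * s))
    have h3 := Nat.floor_le (hnn w i)
    have h4 := Nat.lt_floor_add_one (k * x w i / (2 * s))
    rw [h] at h1 h2
    have h5 : ∀ y : ℝ, y = k * y / (2 * s) * (2 * s / k) := fun y => by field_simp
    have h6 : 0 < 2 * s / k := by positivity
    rw [h5 (x u i), h5 (x w i), ← sub_mul, abs_mul, abs_of_pos h6]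
    refine mul_le_of_le_one_left h6.le ?_
    rw [abs_le]
    constructor <;> linarith
  have h0 := key 0 (congrArg Prod.fst he)
  have h1 := key 1 (congrArg Prod.snd he)
  calc _ ≤ _ := dist_le_abs_add_abs _ _
    _ ≤ 2 * s / k + 2 * s / k := add_le_add h0 h1
    _ = _ := by ring

/-- This fixes the constant 32: both roots are at most `2 * k`, so their difference is at least `1 /
(4 * k)`, and 32 times it pays for an insertion, which costs twice `4 / k` in units of `√E`. -/
lemma sqrt_add_div_le {k N : ℕ} (hk : 0 < k) (hN : N + 1 ≤ (2 * k) ^ 2) :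
    32 * Real.sqrt N + 8 / k ≤ 32 * Real.sqrt (N + 1) := by
  have hk' : (0 : ℝ) < k := by exact_mod_cast hk
  have hN' : (N : ℝ) + 1 ≤ (2 * k) ^ 2 := by exact_mod_cast hN
  have h1 : Real.sqrt (N + 1) ≤ 2 * k := Real.sqrt_le_iff.2 ⟨by positivity, hN'⟩
  have h2 : Real.sqrt N ≤ Real.sqrt (N + 1) := Real.sqrt_le_sqrt (by linarith)
  have h3 := Real.sq_sqrt (Nat.cast_nonneg (α := ℝ) N)
  have h4 := Real.sq_sqrt (show (0 : ℝ) ≤ N + 1 by positivity)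
  have h5 : 1 ≤ (Real.sqrt (N + 1) - Real.sqrt N) * (4 * k) := by nlinarith
  have h6 : 8 / (k : ℝ) ≤ 32 * (Real.sqrt (N + 1) - Real.sqrt N) := by
    rw [div_le_iff₀ hk']; linarith
  linarith

lemma exists_short_tour {E : ℝ} (hE : 0 < E) (hx : ∀ i, x i ∈ square E) (N : ℕ)
    (A : Finset (Fin n)) (hA : A.card = N) :
    ∃ l : List (Fin n), l.Nodup ∧ (∀ w, w ∈ l ↔ w ∈ A) ∧
      tourLength x l ≤ 32 * Real.sqrt N * Real.sqrt E := by
  induction N generalizing A with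
  | zero =>
    rw [Finset.card_eq_zero] at hA
    exact ⟨[], by simp [hA, tourLength]⟩
  | succ N ih =>
    -- The grid size below is `Nat.sqrt N`, which must be positive, so a single point is treated
    -- apart.
    rcases Nat.eq_zero_or_pos N with rfl | hN
    · obtain ⟨a, rfl⟩ := Finset.card_eq_one.1 hA
      refine ⟨[a], by simp, by simp, ?_⟩
      simp only [tourLength, List.nil_append, routeLength, dist_self, add_zero]
      positivity
    have hk : 0 < Nat.sqrt N := Nat.sqrt_pos.2 hN
    have hk2 : N + 1 ≤ (2 * Nat.sqrt N) ^ 2 := by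
      have := Nat.lt_succ_sqrt N
      simp only [Nat.succ_eq_add_one] at this
      nlinarith
    obtain ⟨u, hu, w, hw, huw, hd⟩ := exists_dist_le_of_sq_lt_card x hE hx (A := A) hk
      (by have := Nat.sqrt_le N; omega)
    obtain ⟨l, hl, hlA, hlen⟩ := ih (A.erase w) (by rw [Finset.card_erase_of_mem hw]; omega)
    obtain ⟨l', hp, hl'⟩ := exists_perm_tourLength_insert x
      ((hlA u).2 (Finset.mem_erase.2 ⟨huw, hu⟩)) w
    refine ⟨l', ?_, fun v => ?_, ?_⟩
    · rw [hp.nodup_iff, List.nodup_cons]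
      exact ⟨fun h => by simpa using (hlA w).1 h, hl⟩
    · rw [hp.mem_iff, List.mem_cons, hlA, Finset.mem_erase]
      by_cases h : v = w <;> simp [h, hw]
    · have h1 := mul_le_mul_of_nonneg_right (sqrt_add_div_le hk hk2) (Real.sqrt_nonneg E)
      have h2 : 2 * (4 * Real.sqrt E / Nat.sqrt N) = 8 / (Nat.sqrt N : ℝ) * Real.sqrt E := by ring
      push_cast
      linarith

lemma isTSPConstant_one {E : ℝ} (hE : 0 < E) : IsTSPConstant E 1 32 := by
  intro N _ x hx l hl
  obtain ⟨l', hn, hm, hlen⟩ := exists_short_tour x hE hx N Finset.univ (by simp)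
  refine (hl.2 l' ⟨hn, fun w => (hm w).2 (Finset.mem_univ w)⟩).trans ?_
  rwa [Real.sqrt_mul (Nat.cast_nonneg N), ← mul_assoc]

end Routes

/-! ### The 3/2 approximation ratio of the Christofides tour. -/

section Christofides

variable {n : ℕ} (x : Fin n → Plane)

lemma edgeLength_nonneg (e : Sym2 (Fin n)) : 0 ≤ edgeLength x e := by
  induction e with
  | _ a b => exact dist_nonneg (x := x a) (y := x b)

lemma weight_le_sum {G : SimpleGraph (Fin n)} {s : Finset (Sym2 (Fin n))}
    (h : ∀ e ∈ G.edgeSet, e ∈ s) : weight x G ≤ ∑ e ∈ s, edgeLength x e :=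
  Finset.sum_le_sum_of_subset_of_nonneg (fun e he => h e (SimpleGraph.mem_edgeFinset.1 he))
    fun e _ _ => edgeLength_nonneg x e

lemma weight_bot_le : weight x ⊥ ≤ 0 :=
  (weight_le_sum x (s := ∅) fun e he => by simp at he).trans_eq Finset.sum_empty

lemma weight_mono {G H : SimpleGraph (Fin n)} (h : G ≤ H) : weight x G ≤ weight x H :=
  weight_le_sum x fun _ he => SimpleGraph.mem_edgeFinset.2 (SimpleGraph.edgeSet_mono h he)

lemma weight_edge_sup_le (a b : Fin n) (G : SimpleGraph (Fin n)) :
    weight x (SimpleGraph.edge a b ⊔ G) ≤ dist (x a) (x b) + weight x G := by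
  have h1 : weight x (SimpleGraph.edge a b ⊔ G) ≤
      ∑ e ∈ insert s(a, b) G.edgeFinset, edgeLength x e := by
    refine weight_le_sum x fun e he => ?_
    rw [SimpleGraph.edgeSet_sup] at he
    rw [Finset.mem_insert, SimpleGraph.mem_edgeFinset]
    exact he.imp (fun h => SimpleGraph.edgeSet_edge_subset h) id
  refine h1.trans ?_
  by_cases h : s(a, b) ∈ G.edgeFinset
  · rw [Finset.insert_eq_of_mem h]
    exact le_add_of_nonneg_left dist_nonneg
  · rw [Finset.sum_insert h]
    exact le_rfl

/-! ### The path through the points of a list -/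

/-- The graph whose edges join consecutive points of a list. -/
def pathOf : List (Fin n) → SimpleGraph (Fin n)
  | [] => ⊥
  | [_] => ⊥
  | a :: b :: l => SimpleGraph.edge a b ⊔ pathOf (b :: l)

lemma weight_pathOf_le (a : Fin n) (l : List (Fin n)) :
    weight x (pathOf (a :: l)) ≤ routeLength x (x a) l := by
  induction l generalizing a with
  | nil => exact weight_bot_le x
  | cons b l ih =>
    exact (weight_edge_sup_le x a b _).trans (by simpa [routeLength] using ih b)

lemma pathOf_reachable (a : Fin n) (l : List (Fin n)) {w : Fin n} (hw : w ∈ a :: l) :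
    (pathOf (a :: l)).Reachable a w := by
  induction l generalizing a with
  | nil => rw [List.mem_singleton.1 hw]
  | cons b l ih =>
    rcases List.mem_cons.1 hw with rfl | hw
    · exact SimpleGraph.Reachable.refl _
    · refine SimpleGraph.Reachable.trans ?_ ((ih b hw).mono le_sup_right)
      by_cases hab : a = b
      · rw [hab]
      · exact SimpleGraph.Adj.reachable (Or.inl ((SimpleGraph.edge_adj a b a b).2 (by simp [hab])))

/-- A tour without its closing edge is a connected spanning graph, hence contains a spanning tree.
-/
lemma IsMST.weight_le_tourLength {T : SimpleGraph (Fin n)} (hT : IsMST x T) {l : List (Fin n)}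
    (hl : IsTour l) : weight x T ≤ tourLength x l := by
  cases l with
  | nil =>
    obtain ⟨w⟩ := hT.1.connected.nonempty
    simpa using hl.2 w
  | cons a l =>
    have hc : (pathOf (a :: l)).Connected := by
      refine (SimpleGraph.connected_iff _).2 ⟨fun u w => ?_, ⟨a⟩⟩
      exact (pathOf_reachable a l (hl.2 u)).symm.trans (pathOf_reachable a l (hl.2 w))
    obtain ⟨T', hle, hT'⟩ := hc.exists_isTree_le
    calc weight x T ≤ weight x T' := hT.2 T' hT'
      _ ≤ weight x (pathOf (a :: l)) := weight_mono x hle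
      _ ≤ routeLength x (x a) l := weight_pathOf_le x a l
      _ ≤ tourLength x (a :: l) := routeLength_sublist x (List.sublist_append_left _ _) _

/-! ### Matchings along a tour -/

/-- The graph that matches the first point of a list with the second, the third with the fourth,
and so on. -/
def pairing : List (Fin n) → SimpleGraph (Fin n)
  | [] => ⊥
  | [_] => ⊥
  | a :: b :: l => SimpleGraph.edge a b ⊔ pairing l

/-- Total length of the pairs matched by `pairing`. -/
def pairLength : List (Fin n) → ℝ
  | [] => 0
  | [_] => 0
  | a :: b :: l => dist (x a) (x b) + pairLength l

lemma weight_pairing_le : ∀ l : List (Fin n), weight x (pairing l) ≤ pairLength x l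
  | [] => weight_bot_le x
  | [_] => weight_bot_le x
  | a :: b :: l =>
    (weight_edge_sup_le x a b _).trans (add_le_add le_rfl (weight_pairing_le l))

/-- Pairing from the first point and pairing from the second use alternate edges of the path, hence
together each edge once. -/
lemma pairLength_cons_add (a : Fin n) (l : List (Fin n)) :
    pairLength x (a :: l) + pairLength x l = routeLength x (x a) l := by
  induction l generalizing a with
  | nil => simp [pairLength, routeLength]
  | cons b l ih =>
    simp only [pairLength, routeLength]
    linarith [ih b]

lemma pairLength_append_singleton (a : Fin n) :
    ∀ l : List (Fin n), Even l.length → pairLength x (l ++ [a]) = pairLength x l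
  | [], _ => rfl
  | [_], h => by simp at h
  | b :: c :: l, h => by
    have := pairLength_append_singleton a l (by simpa [Nat.even_add] using h)
    simp [pairLength, this]

lemma mem_of_pairing_adj {v u : Fin n} :
    ∀ {l : List (Fin n)}, (pairing l).Adj v u → v ∈ l
  | [], h => h.elim
  | [_], h => h.elim
  | a :: b :: l, h => by
    rcases h with h | h
    · rw [SimpleGraph.edge_adj] at h
      rcases h.1 with h | h <;> simp [h.1]
    · simp [mem_of_pairing_adj h]

lemma existsUnique_pairing_adj {v : Fin n} :
    ∀ {l : List (Fin n)}, l.Nodup → Even l.length → v ∈ l → ∃! u, (pairing l).Adj v u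
  | [], _, _, h => by simp at h
  | [_], _, h, _ => by simp at h
  | a :: b :: l, hn, he, hv => by
    simp only [List.nodup_cons, List.mem_cons, not_or] at hn
    obtain ⟨⟨hab, hal⟩, hbl, hn⟩ := hn
    have hadj : ∀ u, (pairing (a :: b :: l)).Adj v u ↔
        ((v = a ∧ u = b ∨ v = b ∧ u = a) ∧ v ≠ u) ∨ (pairing l).Adj v u := fun u =>
      or_congr (SimpleGraph.edge_adj a b v u) Iff.rfl
    simp only [hadj]
    rcases List.mem_cons.1 hv with rfl | hv'
    · refine ⟨b, Or.inl ⟨Or.inl ⟨rfl, rfl⟩, hab⟩, ?_⟩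
      rintro u (⟨⟨-, rfl⟩ | ⟨h, -⟩, -⟩ | h)
      · rfl
      · exact (hab h).elim
      · exact (hal (mem_of_pairing_adj h)).elim
    rcases List.mem_cons.1 hv' with rfl | hvl
    · refine ⟨a, Or.inl ⟨Or.inr ⟨rfl, rfl⟩, Ne.symm hab⟩, ?_⟩
      rintro u (⟨⟨h, -⟩ | ⟨-, rfl⟩, -⟩ | h)
      · exact (hab h.symm).elim
      · rfl
      · exact (hbl (mem_of_pairing_adj h)).elim
    · obtain ⟨u, hu, huu⟩ := existsUnique_pairing_adj hn (by simpa [Nat.even_add] using he) hvl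
      refine ⟨u, Or.inr hu, ?_⟩
      rintro u' (⟨⟨rfl, -⟩ | ⟨rfl, -⟩, -⟩ | h)
      · exact (hal hvl).elim
      · exact (hbl hvl).elim
      · exact huu u' h

lemma isOddMatching_pairing {T : SimpleGraph (Fin n)} {l : List (Fin n)} (hn : l.Nodup)
    (he : Even l.length) (hl : ∀ v, v ∈ l ↔ Odd (T.degree v)) : IsOddMatching T (pairing l) := by
  intro v
  split_ifs with h <;> rw [← hl] at h
  · exact SimpleGraph.degree_eq_one_iff_existsUnique_adj.2 (existsUnique_pairing_adj hn he h)
  · rw [SimpleGraph.degree_eq_zero_iff_notMem_support, SimpleGraph.mem_support]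
    rintro ⟨u, hu⟩
    exact h (mem_of_pairing_adj hu)

/-- Shortcutting the tour to the odd-degree vertices gives a cycle through an even number of points.
Its edges split into two perfect matchings, neither shorter than `M`. -/
lemma IsMinOddMatching.two_mul_weight_le_tourLength {T M : SimpleGraph (Fin n)}
    (hM : IsMinOddMatching x T M) {l : List (Fin n)} (hl : IsTour l) :
    2 * weight x M ≤ tourLength x l := by
  set o := l.filter fun v => Odd (T.degree v) with ho
  have hmem : ∀ v, v ∈ o ↔ Odd (T.degree v) := fun v => by simp [ho, hl.2 v]
  have hn : o.Nodup := hl.1.filter _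
  have he : Even o.length := by
    rw [← List.toFinset_card_of_nodup hn]
    convert T.even_card_odd_degree_vertices using 2
    ext v
    simp [hmem]
  refine le_trans ?_ (tourLength_sublist x (show o.Sublist l from List.filter_sublist))
  cases h : o with
  | nil =>
    rw [h] at hn he hmem
    have := (hM.2 _ (isOddMatching_pairing hn he hmem)).trans (weight_pairing_le x _)
    simp only [pairLength] at this
    simp only [tourLength]
    linarith
  | cons a t =>
    rw [h] at hn he hmem
    have hp : (t ++ [a]).Perm (a :: t) := List.perm_append_singleton a t
    have h1 := (hM.2 _ (isOddMatching_pairing hn he hmem)).trans (weight_pairing_le x _)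
    -- The second matching pairs the list rotated by one place.
    have h2 := (hM.2 _ (isOddMatching_pairing (hp.nodup_iff.2 hn) (by rwa [hp.length_eq])
      fun v => (hp.mem_iff).trans (hmem v))).trans (weight_pairing_le x _)
    -- In `a :: t ++ [a]` the final `a` stays unpaired, so `h4` splits the closed cycle into exactly
    -- the two pairings.
    have h3 := pairLength_append_singleton x a (a :: t) he
    have h4 := pairLength_cons_add x a (t ++ [a])
    rw [List.cons_append] at h3
    simp only [tourLength]
    linarith

/-! ### The approximation ratio -/

/-- The appended `v` repeats the endpoint at no cost; it gives the left side the shape of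
`tourLength` of the support when the walk is closed. -/
lemma routeLength_walk_support {G : SimpleGraph (Fin n)} {u v : Fin n} (c : G.Walk u v) :
    routeLength x (x u) (c.support.tail ++ [v]) = (c.edges.map (edgeLength x)).sum := by
  induction c with
  | nil => simp [routeLength]
  | @cons a b d h c ih =>
    rw [SimpleGraph.Walk.support_cons, List.tail_cons, SimpleGraph.Walk.edges_cons,
      List.map_cons, List.sum_cons, ← ih]
    rw [← SimpleGraph.Walk.cons_tail_support c, List.cons_append]
    rfl

lemma exists_isShortestTour : ∃ l, IsShortestTour x l := by
  have hfin : {l : List (Fin n) | IsTour l}.Finite := by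
    refine (List.finite_length_eq (Fin n) n).subset fun l hl => ?_
    have h : l.toFinset = Finset.univ := by ext w; simp [hl.2 w]
    have := List.toFinset_card_of_nodup hl.1
    rw [h] at this
    simpa using this.symm
  obtain ⟨l, hl, hmin⟩ := Set.exists_min_image _ (tourLength x) hfin
    ⟨List.finRange n, List.nodup_finRange n, List.mem_finRange⟩
  exact ⟨l, hl, hmin⟩

lemma IsChristofidesTour.tourLength_le {tour l : List (Fin n)} (ht : IsChristofidesTour x tour)
    (hl : IsTour l) : tourLength x tour ≤ 3 / 2 * tourLength x l := by
  obtain ⟨-, T, M, hT, hM, v, c, hc, hsub⟩ := ht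
  have h1 := tourLength_sublist x hsub
  have h2 : tourLength x c.support = weight x T + weight x M := by
    rw [← SimpleGraph.Walk.cons_tail_support c]
    simp only [tourLength]
    rw [routeLength_walk_support, ← Multiset.sum_coe, ← Multiset.map_coe, hc, Multiset.map_add,
      Multiset.sum_add]
    rfl
  have h3 := hT.weight_le_tourLength x hl
  have h4 := hM.two_mul_weight_le_tourLength x hl
  linarith

end Christofides

/-! ### Motion during one sampling period. -/

section Motion

variable {n : ℕ} (x : Fin n → Plane)

/-- Motion runs along the route itself, so it leaves the planned total unchanged. -/
lemma move_length_add_routeLength (p : Plane) (l : List (Fin n)) {b : ℝ} (hb : 0 ≤ b) :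
    (move x p l b).length + routeLength x (move x p l b).pos (move x p l b).route =
      routeLength x p l := by
  induction l generalizing p b with
  | nil => simp [move, routeLength]
  | cons w l ih =>
    by_cases h : dist p (x w) ≤ b
    · simp only [move, if_pos h, routeLength]
      linarith [ih (x w) (sub_nonneg.2 h)]
    · have hd : 0 < dist p (x w) := hb.trans_lt (not_le.1 h)
      have key : dist (p + (b / dist p (x w)) • (x w - p)) (x w) = dist p (x w) - b := by
        have h1 : p + (b / dist p (x w)) • (x w - p) - x w =
            (1 - b / dist p (x w)) • (p - x w) := by module
        have h2 : b / dist p (x w) ≤ 1 := (div_le_one hd).2 (not_le.1 h).le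
        rw [dist_eq_norm, h1, norm_smul, Real.norm_of_nonneg (sub_nonneg.2 h2), ← dist_eq_norm]
        field_simp
      simp only [move, if_neg h, routeLength, key]
      ring

lemma move_length_nonneg (p : Plane) (l : List (Fin n)) {b : ℝ} (hb : 0 ≤ b) :
    0 ≤ (move x p l b).length := by
  induction l generalizing p b with
  | nil => simp [move]
  | cons w l ih =>
    by_cases h : dist p (x w) ≤ b
    · simp only [move, if_pos h]
      exact add_nonneg dist_nonneg (ih (x w) (sub_nonneg.2 h))
    · simpa only [move, if_neg h] using hb

lemma mem_reached_or_mem_route (p : Plane) (l : List (Fin n)) (b : ℝ) {w : Fin n} (hw : w ∈ l) :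
    w ∈ (move x p l b).reached ∨ w ∈ (move x p l b).route := by
  induction l generalizing p b with
  | nil => simp at hw
  | cons v l ih =>
    by_cases h : dist p (x v) ≤ b
    · simp only [move, if_pos h, Finset.mem_insert]
      rcases List.mem_cons.1 hw with rfl | hw
      · exact Or.inl (Or.inl rfl)
      · exact (ih (x v) (b - dist p (x v)) hw).imp_left Or.inr
    · simp only [move, if_neg h]
      exact Or.inr hw

lemma move_progress (p : Plane) {l : List (Fin n)} (hl : l ≠ []) (b : ℝ) :
    (∃ w ∈ l, w ∈ (move x p l b).reached) ∨ (move x p l b).length = b := by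
  cases l with
  | nil => exact (hl rfl).elim
  | cons v l =>
    by_cases h : dist p (x v) ≤ b
    · exact Or.inl ⟨v, by simp, by simp [move, if_pos h]⟩
    · exact Or.inr (by simp [move, if_neg h])

end Motion

/-! ### Groups partition the robots. -/

section Groups

variable {m n : ℕ} (r : ℝ) (S : State m n)

lemma mem_group {j k : Fin m} : k ∈ group r S j ↔ (commGraph r S.pos).Reachable j k := by
  simp [group]

lemma self_mem_group (j : Fin m) : j ∈ group r S j :=
  (mem_group r S).2 (SimpleGraph.Reachable.refl _)

lemma group_eq_of_mem {j k : Fin m} (h : k ∈ group r S j) : group r S k = group r S j := by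
  rw [mem_group] at h
  ext i
  rw [mem_group, mem_group]
  exact ⟨h.trans, h.symm.trans⟩

lemma sum_le_sum_of_groups {f g : Fin m → ℝ}
    (h : ∀ j, ∑ k ∈ group r S j, f k ≤ ∑ k ∈ group r S j, g k) : ∑ j, f j ≤ ∑ j, g j := by
  have hm : ∀ j ∈ (Finset.univ : Finset (Fin m)), group r S j ∈ Finset.univ.image (group r S) :=
    fun j _ => Finset.mem_image_of_mem _ (Finset.mem_univ j)
  rw [← Finset.sum_fiberwise_of_maps_to hm f, ← Finset.sum_fiberwise_of_maps_to hm g]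
  refine Finset.sum_le_sum fun C hC => ?_
  obtain ⟨j, -, rfl⟩ := Finset.mem_image.1 hC
  have hf : Finset.univ.filter (fun k => group r S k = group r S j) = group r S j := by
    ext k
    rw [Finset.mem_filter_univ]
    exact ⟨fun hk => hk ▸ self_mem_group r S k, group_eq_of_mem r S⟩
  rw [hf]
  exact h j

end Groups

/-! ### What a group decision preserves. -/

section Decisions

variable {m n : ℕ} {x : Fin n → Plane} {S : State m n} {C : Finset (Fin m)}
  {ρ : Fin m → List (Fin n)}

lemma IsCoopTargets.exists_mem_route {T : Finset (Fin n)} (hT : IsCoopTargets x S C T)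
    {w : Fin n} (hw : w ∈ T) : ∃ k ∈ C, w ∈ S.route k := by
  rcases hT with ⟨p, hp, -, -, rfl⟩ | ⟨-, -, rfl⟩
  · exact ⟨p, (Finset.mem_filter.1 hp).1, List.mem_toFinset.1 hw⟩
  · obtain ⟨k, hk, hwk⟩ := Finset.mem_biUnion.1 hw
    exact ⟨k, (Finset.mem_sdiff.1 hk).1, List.mem_toFinset.1 hwk⟩

lemma GroupDecides.exists_mem_route (h : GroupDecides x S C ρ) {j : Fin m} (hj : j ∈ C)
    {w : Fin n} (hw : w ∈ ρ j) : ∃ k ∈ C, w ∈ S.route k := by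
  have keep : Keeps S C ρ → ∃ k ∈ C, w ∈ S.route k := fun hk => ⟨j, hj, hk j hj ▸ hw⟩
  rcases h with ⟨-, hk⟩ | ⟨-, -, T, cand, hT, hdiv, ⟨-, hρ⟩ | ⟨-, hk⟩⟩
  · exact keep hk
  · exact hT.exists_mem_route ((hdiv.2.2 w).2 ⟨j, hj, hρ j hj ▸ hw⟩)
  · exact keep hk

lemma GroupDecides.sum_planned_le (h : GroupDecides x S C ρ) :
    ∑ j ∈ C, planned x { S with route := ρ } j ≤ ∑ j ∈ C, planned x S j := by
  have keep : Keeps S C ρ →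
      ∑ j ∈ C, planned x { S with route := ρ } j ≤ ∑ j ∈ C, planned x S j := fun hk =>
    (Finset.sum_congr rfl fun j hj => by simp only [planned, hk j hj]).le
  rcases h with ⟨-, hk⟩ | ⟨-, -, T, cand, -, -, ⟨hlt, hρ⟩ | ⟨-, hk⟩⟩
  · exact keep hk
  · refine le_of_eq_of_le (Finset.sum_congr rfl fun j hj => ?_) hlt.le
    simp only [planned, hρ j hj]
  · exact keep hk

/-- The robot `j` has never been connected with another robot. -/
def IsFresh (S : State m n) (j : Fin m) : Prop := ∀ k ∈ S.met j, k = j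

lemma mem_fresh {j : Fin m} : j ∈ fresh S C ↔ j ∈ C ∧ IsFresh S j := Finset.mem_filter

/-- A target survives the decision of a group if it is on the routes of all fresh robots of the
group and, unless all robots of the group are fresh, on the route of some other robot. -/
lemma GroupDecides.exists_mem (h : GroupDecides x S C ρ) {w : Fin n} (hne : C.Nonempty)
    (hf : ∀ j ∈ C, IsFresh S j → w ∈ S.route j)
    (hw : (∀ j ∈ C, IsFresh S j) ∨ ∃ j ∈ C, ¬ IsFresh S j ∧ w ∈ S.route j) :
    ∃ k ∈ C, w ∈ ρ k := by
  have keep : Keeps S C ρ → ∃ k ∈ C, w ∈ ρ k := fun hk => by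
    rcases hw with hw | ⟨j, hj, -, hwj⟩
    · obtain ⟨j, hj⟩ := hne
      exact ⟨j, hj, hk j hj ▸ hf j hj (hw j hj)⟩
    · exact ⟨j, hj, hk j hj ▸ hwj⟩
  rcases h with ⟨-, hk⟩ | ⟨-, -, T, cand, hT, hdiv, ⟨-, hρ⟩ | ⟨-, hk⟩⟩
  · exact keep hk
  · have hwT : w ∈ T := by
      rcases hT with ⟨p, hp, -, -, rfl⟩ | ⟨hC, -, rfl⟩
      · exact List.mem_toFinset.2 (hf p (mem_fresh.1 hp).1 (mem_fresh.1 hp).2)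
      · rcases hw with hw | ⟨j, hj, hjf, hwj⟩
        · refine (hC ?_).elim
          rw [Finset.sdiff_eq_empty_iff_subset]
          exact fun j hj => mem_fresh.2 ⟨hj, hw j hj⟩
        · refine Finset.mem_biUnion.2 ⟨j, Finset.mem_sdiff.2 ⟨hj, ?_⟩, List.mem_toFinset.2 hwj⟩
          exact fun h => hjf (mem_fresh.1 h).2
    obtain ⟨k, hk, hwk⟩ := (hdiv.2.2 w).1 hwT
    exact ⟨k, hk, (hρ k hk).symm ▸ hwk⟩
  · exact keep hk

end Decisions

/-! ### Potential, progress and coverage along an execution. -/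

section Execution

variable {m n : ℕ} {x : Fin n → Plane} {r δ : ℝ} {S S' : State m n}

lemma planned_exchange_le (j : Fin m) : planned x (exchange r S) j ≤ planned x S j :=
  add_le_add le_rfl (routeLength_sublist x List.filter_sublist _)

lemma Step.sum_planned_le (hδ : 0 ≤ δ) (h : Step x r δ S S') :
    ∑ j, planned x S' j ≤ ∑ j, planned x S j := by
  obtain ⟨ρ, hρ, rfl⟩ := h
  calc _ = ∑ j, planned x { exchange r S with route := ρ } j := by
        refine Finset.sum_congr rfl fun j _ => ?_
        simp only [planned, exchange]
        linarith [move_length_add_routeLength x (S.pos j) (ρ j) hδ]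
    _ ≤ ∑ j, planned x (exchange r S) j :=
        sum_le_sum_of_groups r S fun j => (hρ j).sum_planned_le
    _ ≤ _ := Finset.sum_le_sum fun j _ => planned_exchange_le j

/-- Pooling removes the group's known visits from every member's route, and a decision only
redistributes what remains. Hence each target reached in the period is new to the robot that reaches
it. -/
lemma notMem_known_of_mem_route {ρ : Fin m → List (Fin n)} {j : Fin m}
    (h : GroupDecides x (exchange r S) (group r S j) ρ) {w : Fin n} (hw : w ∈ ρ j) :
    w ∉ (exchange r S).known j := by
  obtain ⟨k, hk, hwk⟩ := h.exists_mem_route (self_mem_group r S j) hw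
  have := (List.mem_filter.1 hwk).2
  rw [group_eq_of_mem r S hk] at this
  exact of_decide_eq_true this

/-- Work done so far: the travelled distance in sampling periods, plus the visits known. -/
def progress (δ : ℝ) (S : State m n) : ℝ :=
  ∑ j, (S.travelled j / δ + (S.known j).card)

lemma known_subset_exchange (j : Fin m) : S.known j ⊆ (exchange r S).known j :=
  Finset.subset_biUnion_of_mem S.known (self_mem_group r S j)

lemma Step.travelled_le (hδ : 0 ≤ δ) (h : Step x r δ S S') (j : Fin m) :
    S.travelled j ≤ S'.travelled j := by
  obtain ⟨ρ, -, rfl⟩ := h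
  exact le_add_of_nonneg_right (move_length_nonneg x _ _ hδ)

lemma Step.known_subset (h : Step x r δ S S') (j : Fin m) : S.known j ⊆ S'.known j := by
  obtain ⟨ρ, -, rfl⟩ := h
  exact (known_subset_exchange j).trans Finset.subset_union_left

lemma Step.progress_term_le (hδ : 0 ≤ δ) (h : Step x r δ S S') (j : Fin m) :
    S.travelled j / δ + (S.known j).card ≤ S'.travelled j / δ + (S'.known j).card :=
  add_le_add (div_le_div_of_nonneg_right (h.travelled_le hδ j) hδ)
    (Nat.cast_le.2 (Finset.card_le_card (h.known_subset j)))

lemma Step.progress_le (hδ : 0 ≤ δ) (h : Step x r δ S S') : progress δ S ≤ progress δ S' :=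
  Finset.sum_le_sum fun j _ => h.progress_term_le hδ j

/-- In a sampling period without a unit of progress no robot moves. -/
lemma Step.idle (hδ : 0 < δ) (h : Step x r δ S S') (hlt : progress δ S' < progress δ S + 1)
    (j : Fin m) : S'.route j = [] ∧ S'.travelled j = S.travelled j := by
  have hs := h
  obtain ⟨ρ, hρ, rfl⟩ := h
  by_cases hj : ρ j = []
  · simp [hj, move]
  exfalso
  refine hlt.not_ge ?_
  set S' : State m n := _
  change progress δ S + 1 ≤ progress δ S'
  have hterm : S.travelled j / δ + (S.known j).card + 1 ≤
      S'.travelled j / δ + (S'.known j).card := by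
    -- Reaching a target enlarges `known j`; otherwise the robot moves for the full time `δ`. Either
    -- way its term gains 1.
    rcases move_progress x (S.pos j) hj δ with ⟨w, hw, hwr⟩ | hlen
    · have h1 : (S.known j).card + 1 ≤ (S'.known j).card := by
        have hw' : w ∉ S.known j := fun hk =>
          notMem_known_of_mem_route (hρ j) hw (known_subset_exchange j hk)
        rw [← Finset.card_insert_of_notMem hw']
        refine Finset.card_le_card (Finset.insert_subset ?_ (hs.known_subset j))
        exact Finset.mem_union_right _ hwr
      have h2 := div_le_div_of_nonneg_right (hs.travelled_le hδ.le j) hδ.le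
      have h3 : ((S.known j).card : ℝ) + 1 ≤ (S'.known j).card := by exact_mod_cast h1
      linarith
    · have h1 : S'.travelled j = S.travelled j + δ := congrArg (S.travelled j + ·) hlen
      have h2 : ((S.known j).card : ℝ) ≤ (S'.known j).card :=
        Nat.cast_le.2 (Finset.card_le_card (hs.known_subset j))
      rw [h1, add_div, div_self hδ.ne']
      linarith
  unfold progress
  rw [← Finset.add_sum_erase _ _ (Finset.mem_univ j),
    ← Finset.add_sum_erase _ (fun j => S'.travelled j / δ + ((S'.known j).card : ℝ))
      (Finset.mem_univ j)]
  have := Finset.sum_le_sum fun k (_ : k ∈ Finset.univ.erase j) => hs.progress_term_le hδ.le k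
  linarith

/-- No target is lost: fresh robots have all targets that they do not know to be visited on their
routes, and once there are other robots, these have all unvisited targets on their routes. -/
structure Covers (S : State m n) : Prop where
  visited_of_known : ∀ j, ∀ w ∈ S.known j, ∃ k, w ∈ S.visited k
  mem_route_of_fresh : ∀ j, IsFresh S j → ∀ w, w ∉ S.known j → w ∈ S.route j
  covered : (∀ j, IsFresh S j) ∨
    ∀ w, (∃ k, w ∈ S.visited k) ∨ ∃ k, ¬ IsFresh S k ∧ w ∈ S.route k

/-- Cooperative targets come either from one fresh robot or from the non-fresh robots of the group.
The invariant places an unvisited target on every fresh route and, once non-fresh robots exist, on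
the route of one of them; in that robot's group both choices contain the target. -/
lemma Covers.step (hS : Covers S) (h : Step x r δ S S') : Covers S' := by
  obtain ⟨ρ, hρ, rfl⟩ := h
  set S' : State m n := _
  change Covers S'
  have hfresh : ∀ j, IsFresh S' j → IsFresh S j ∧ ∀ k ∈ group r S j, k = j := fun j hj =>
    ⟨fun k hk => hj k (Finset.mem_union_left _ hk), fun k hk => hj k (Finset.mem_union_right _ hk)⟩
  have hvis : ∀ {w}, (∃ k, w ∈ S.visited k) → ∃ k, w ∈ S'.visited k := fun ⟨k, hk⟩ =>
    ⟨k, Finset.mem_union_left _ hk⟩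
  refine ⟨fun j w hw => ?_, fun j hj w hw => ?_, ?_⟩
  · rcases Finset.mem_union.1 hw with hw | hw
    · obtain ⟨k, -, hk⟩ := Finset.mem_biUnion.1 hw
      exact hvis (hS.visited_of_known k w hk)
    · exact ⟨j, Finset.mem_union_right _ hw⟩
  · obtain ⟨hjf, hg⟩ := hfresh j hj
    have hw1 : w ∉ (exchange r S).known j := fun h => hw (Finset.mem_union_left _ h)
    have hw2 := fun h => hw (Finset.mem_union_right _ h)
    have hwj : w ∈ (exchange r S).route j := List.mem_filter.2
      ⟨hS.mem_route_of_fresh j hjf w fun h => hw1 (known_subset_exchange j h),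
        decide_eq_true hw1⟩
    -- A robot still fresh after the step is alone in its group.
    have hex : ∃ k ∈ group r S j, w ∈ ρ k := (hρ j).exists_mem ⟨j, self_mem_group r S j⟩
      (fun k hk _ => by rwa [hg k hk]) (Or.inl fun k hk => by rw [hg k hk]; exact hjf)
    obtain ⟨k, hk, hwk⟩ := hex
    rw [hg k hk] at hwk
    exact (mem_reached_or_mem_route x (S.pos j) (ρ j) δ hwk).resolve_left hw2
  · by_contra! hcon
    obtain ⟨⟨j₀, hj₀⟩, w, hwv, hwr⟩ := hcon
    have hwk : ∀ j, w ∉ (exchange r S).known j := fun j hj => by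
      obtain ⟨k, -, hk⟩ := Finset.mem_biUnion.1 hj
      obtain ⟨i, hi⟩ := hvis (hS.visited_of_known k w hk)
      exact hwv i hi
    have hex : ∀ j, w ∈ S.route j → w ∈ (exchange r S).route j := fun j hj =>
      List.mem_filter.2 ⟨hj, decide_eq_true (hwk j)⟩
    have hf : ∀ j, IsFresh S j → w ∈ (exchange r S).route j := fun j hj =>
      hex j (hS.mem_route_of_fresh j hj w fun h => hwk j (known_subset_exchange j h))
    -- If all robots were fresh so far, the group of a robot that has just met another retains `w`;
    -- otherwise the group of a non-fresh carrier of `w` does.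
    have main : ∃ j, (¬ IsFresh S' j) ∧ ∃ k ∈ group r S j, w ∈ ρ k := by
      rcases hS.covered with hall | hcov
      · exact ⟨j₀, hj₀, (hρ j₀).exists_mem ⟨j₀, self_mem_group r S j₀⟩ (fun k _ => hf k)
          (Or.inl fun k _ => hall k)⟩
      · obtain ⟨k, hk⟩ | ⟨j, hj, hwj⟩ := hcov w
        · obtain ⟨i, hi⟩ := hvis ⟨k, hk⟩
          exact (hwv i hi).elim
        · exact ⟨j, fun h => hj (hfresh j h).1, (hρ j).exists_mem ⟨j, self_mem_group r S j⟩
            (fun k _ => hf k) (Or.inr ⟨j, self_mem_group r S j, hj, hex j hwj⟩)⟩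
    obtain ⟨j, hj, k, hk, hwk⟩ := main
    -- A robot fresh after the step is its whole group, which would force `k = j`.
    have hkf : ¬ IsFresh S' k := fun h => by
      have hjk := (hfresh k h).2 j (by rw [group_eq_of_mem r S hk]; exact self_mem_group r S j)
      exact hj (hjk ▸ h)
    rcases mem_reached_or_mem_route x (S.pos k) (ρ k) δ hwk with h | h
    · exact hwv k (Finset.mem_union_right _ h)
    · exact hwr k hkf h

lemma FollowsTour.mem {tour l : List (Fin n)} (hl : FollowsTour tour l) (ht : IsTour tour)
    (w : Fin n) : w ∈ l := by
  rcases hl with h | h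
  · exact h.mem_iff.2 (ht.2 w)
  · exact h.mem_iff.2 (List.mem_reverse.2 (ht.2 w))

lemma IsInitial.covers {p : Fin m → Plane} {tour : List (Fin n)} (h : IsInitial x p tour S)
    (ht : IsTour tour) : Covers S := by
  obtain ⟨-, -, hr, hk, hm, -⟩ := h
  exact ⟨fun j w hw => by simp [hk] at hw, fun j _ w _ => (hr j).1.mem ht w,
    Or.inl fun j k hk => by simp [hm] at hk⟩

lemma IsInitial.sum_planned_le {E : ℝ} (hE : 0 ≤ E) {p : Fin m → Plane} {tour : List (Fin n)}
    (h : IsInitial x p tour S) (hx : ∀ i, x i ∈ square E) (hp : ∀ j, p j ∈ square E) :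
    ∑ j, planned x S j ≤ m * (Real.sqrt (2 * E) + tourLength x tour) := by
  obtain ⟨-, hpos, hr, -, -, -, htr, -⟩ := h
  have hj : ∀ j ∈ Finset.univ, planned x S j ≤ Real.sqrt (2 * E) + tourLength x tour := by
    intro j _
    simp only [planned, htr, hpos, zero_add]
    -- The chosen route is no longer than the one that enters the tour at its listed head, which
    -- needs no closing edge.
    refine ((hr j).2 tour (Or.inl (List.IsRotated.refl _))).trans ?_
    cases tour with
    | nil =>
      exact add_nonneg (Real.sqrt_nonneg _) le_rfl
    | cons a l =>
      exact add_le_add (dist_le_of_mem_square hE (hp j) (hx a))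
        (routeLength_sublist x (List.sublist_append_left _ _) _)
  refine (Finset.sum_le_card_nsmul _ _ _ hj).trans_eq ?_
  rw [Finset.card_univ, Fintype.card_fin, nsmul_eq_mul]

lemma travelled_le_planned (j : Fin m) : S.travelled j ≤ planned x S j :=
  le_add_of_nonneg_right (routeLength_nonneg _ _ _)

/-- Beyond an index where the sequence exceeds its supremum minus 1, no step can gain 1. -/
lemma exists_forall_lt_add_one {a : ℕ → ℝ} (ha : Monotone a) {B : ℝ} (hB : ∀ k, a k ≤ B) :
    ∃ K, ∀ k, K ≤ k → a (k + 1) < a k + 1 := by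
  have hbdd : BddAbove (Set.range a) := ⟨B, by rintro _ ⟨k, rfl⟩; exact hB k⟩
  obtain ⟨K, hK⟩ := exists_lt_of_lt_ciSup (sub_one_lt (iSup a))
  exact ⟨K, fun k hk => by linarith [le_ciSup hbdd (k + 1), ha hk]⟩

lemma IsExecution.eventually_done {p : Fin m → Plane} {tour : List (Fin n)} {S : ℕ → State m n}
    (hm : 1 ≤ m) (hδ : 0 < δ) (ht : IsTour tour) (h : IsExecution x p r δ tour S) :
    ∃ K : ℕ, (∀ w, ∃ j, w ∈ (S K).visited j) ∧
      (∀ k, K ≤ k → ∀ j, (S k).route j = [] ∧ (S k).travelled j = (S K).travelled j) ∧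
      ∑ j, (S K).travelled j ≤ ∑ j, planned x (S 0) j := by
  obtain ⟨hinit, hstep⟩ := h
  have hplan : ∀ k, ∑ j, (S k).travelled j ≤ ∑ j, planned x (S 0) j := fun k =>
    (Finset.sum_le_sum fun j _ => travelled_le_planned j).trans
      (antitone_nat_of_succ_le (f := fun k => ∑ j, planned x (S k) j)
        (fun k => (hstep k).sum_planned_le hδ.le) (Nat.zero_le k))
  have hcov : ∀ k, Covers (S k) := fun k => by
    induction k with
    | zero => exact hinit.covers ht
    | succ k ih => exact ih.step (hstep k)
  have hbound : ∀ k, progress δ (S k) ≤ (∑ j, planned x (S 0) j) / δ + m * n := fun k => by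
    unfold progress
    rw [Finset.sum_add_distrib, ← Finset.sum_div]
    refine add_le_add (div_le_div_of_nonneg_right (hplan k) hδ.le) ?_
    have : ∀ j ∈ Finset.univ, (((S k).known j).card : ℝ) ≤ n := fun j _ => by
      exact_mod_cast (Finset.card_le_univ _).trans (Fintype.card_fin n).le
    simpa using Finset.sum_le_card_nsmul _ _ _ this
  obtain ⟨K, hK⟩ := exists_forall_lt_add_one
    (monotone_nat_of_le_succ fun k => (hstep k).progress_le hδ.le) hbound
  have hidle : ∀ k, K ≤ k → ∀ j,
      (S (k + 1)).route j = [] ∧ (S (k + 1)).travelled j = (S k).travelled j := fun k hk =>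
    (hstep k).idle hδ (hK k hk)
  -- An idle period starting at `K` guarantees empty routes only at its end, hence `K + 1`.
  refine ⟨K + 1, fun w => ?_, fun k hk j => ?_, hplan _⟩
  · by_contra! hw
    have hnil := fun j => (hidle K le_rfl j).1
    rcases (hcov (K + 1)).covered with hall | hc
    -- If no robots ever met, the first robot alone must have visited or know everything; `1 ≤ m`
    -- provides it.
    · have hwk : w ∉ (S (K + 1)).known ⟨0, hm⟩ := fun h => by
        obtain ⟨i, hi⟩ := (hcov (K + 1)).visited_of_known _ w h
        exact hw i hi
      have := (hcov (K + 1)).mem_route_of_fresh ⟨0, hm⟩ (hall _) w hwk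
      simp [hnil] at this
    · obtain ⟨i, hi⟩ | ⟨i, -, hi⟩ := hc w
      · exact hw i hi
      · simp [hnil] at hi
  · induction k, hk using Nat.le_induction with
    | base => exact ⟨(hidle K le_rfl j).1, rfl⟩
    | succ k hk ih =>
      obtain ⟨h1, h2⟩ := hidle k (by omega) j
      exact ⟨h1, h2.trans ih.2⟩

end Execution

end STSTC

end

theorem mainTheorem4 :
    (∃ c₂ : ℝ, 0 < c₂ ∧ ∀ E : ℝ, 0 < E → STSTC.IsTSPConstant E 1 c₂) ∧
    ∀ (E : ℝ) (c₁ : ℕ) (c₂ : ℝ), 0 < E → 0 < c₂ → STSTC.IsTSPConstant E c₁ c₂ →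
      ∀ (m n : ℕ), 1 ≤ m → 1 ≤ n → c₁ ≤ n →
      ∀ (x : Fin n → STSTC.Plane) (p : Fin m → STSTC.Plane) (r δ : ℝ), 0 < r → 0 < δ →
        (∀ i, x i ∈ STSTC.square E) → (∀ j, p j ∈ STSTC.square E) →
      ∀ tour : List (Fin n), STSTC.IsChristofidesTour x tour →
      ∀ S : ℕ → STSTC.State m n, STSTC.IsExecution x p r δ tour S →
        ∃ K : ℕ,
          (∀ w : Fin n, ∃ j : Fin m, w ∈ (S K).visited j) ∧
          (∀ k, K ≤ k → ∀ j : Fin m,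
            (S k).route j = [] ∧ (S k).travelled j = (S K).travelled j) ∧
          ∑ j : Fin m, (S K).travelled j ≤
            m * (Real.sqrt (2 * E) + (3 / 2) * c₂ * Real.sqrt (n * E)) := by
  refine ⟨⟨32, by norm_num, fun E hE => STSTC.isTSPConstant_one hE⟩, ?_⟩
  intro E c₁ c₂ hE _ hc m n hm _ hcn x p r δ _ hδ hx hp tour ht S hS
  obtain ⟨K, hvis, hidle, hsum⟩ := hS.eventually_done hm hδ ht.1
  refine ⟨K, hvis, hidle, hsum.trans ((hS.1.sum_planned_le hE.le hx hp).trans ?_)⟩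
  obtain ⟨l, hl⟩ := STSTC.exists_isShortestTour x
  have h1 := ht.tourLength_le x hl.1
  have h2 := hc n hcn x hx l hl
  refine mul_le_mul_of_nonneg_left ?_ (Nat.cast_nonneg m)
  linarith
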